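/- An agent has a problem to solve before a deadline $T\in(0,\infty)$ and divides one unit of effort between two arms. The \emph{doing} arm is good with prior probability $\bar p\in(0,1)$; if it is good, a solution, worth $B>0$, arrives on it at rate $\lambda>0$ per unit of effort, and otherwise never. On the \emph{thinking} arm progress arrives at rate $\mu>0$ per unit of effort; progress with time $\tau$ remaining is worth $V(\tau)$. The first arrival ends the game. Here $V:[0,\infty)\to\mathbb R$ is three times continuously differentiable with $V(0)=0$, $V'>0$ and $-V''/V'\ge\bar p\lambda$. Effort has flow cost $c$. Assume that there is no payoff difference: $\lim_{\tau\to\infty}V(\tau)=B$ and $c=0$. Index time by the time $\tau$ remaining. A policy is a measurable function $a:[0,T]\to[0,1]$, where $a_\tau$ is the effort on doing and $1-a_\tau$ the effort on thinking; let $A_\tau=\int_\tau^T a_s\,ds$ and $p_\tau=\bar p e^{-\lambda A_\tau}/(\bar p e^{-\lambda A_\tau}+1-\bar p)$. A policy is optimal if it maximizes \[\int_0^T e^{-\mu(T-\tau-A_\tau)}\bigl(1-\bar p+\bar p e^{-\lambda A_\tau}\bigr)\bigl(\mu(1-a_\tau)V(\tau)+\lambda a_\tau p_\tau B-c\bigr)\,d\tau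 .\] Along a policy, the relative preference for thinking is \[\gamma_\tau=e^{-\mu(T-\tau-A_\tau)}\bigl((1-\bar p+\bar p e^{-\lambda A_\tau})\mu V(\tau)-\bar p e^{-\lambda A_\tau}\lambda B\bigr)-\eta_\tau,\] where $\eta_0=0$ and \[\tfrac{d\eta_\tau}{d\tau}=e^{-\mu(T-\tau-A_\tau)}\Bigl(\mu(1-\bar p)\bigl((1-a_\tau)\mu V(\tau)-c\bigr)-(\lambda-\mu)e^{-\lambda A_\tau}\bar p\bigl((1-a_\tau)\mu V(\tau)+a_\tau\lambda B-c\bigr)\Bigr).\] Consider the equation \[\bar p=\frac{\mu V(\tau)}{B\left(\mu+(\lambda-\mu)e^{-\lambda\tau}\right)}.\tag{$*$}\] Then an optimal policy exists, and every optimal policy has the following properties, where statements about actions hold for almost every $\tau$. (1) Either the agent thinks first and then switches to doing, that is, for some $s\in(0,T)$, $a_\tau=0$ for $\tau\in(s,T)$ and $a_\tau=1$ for $\tau\in(0,s)$; or she does throughout, that is, $a_\tau=1$ for $\tau\in(0,T)$. (2) She starts with a thinking period of positive length if and only if $(*)$ has a solution in $(0,T)$. She weakly prefers thinking at the outset, that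 is, $\gamma_T\ge0$, if and only if $(*)$ has a solution in $(0,T]$. (3) If $(*)$ has a solution in $(0,T]$, then it has a smallest one, $\tau_3$, and the agent thinks for $\tau\in(\tau_3,T)$ and does for $\tau\in(0,\tau_3)$. (If $\tau_3=T$, the thinking period has length zero.) Moreover, $(*)$ has a solution in $(0,\infty)$, so that it has one in $(0,T]$ as soon as $T$ is large enough. -/

import Mathlib

open Set Filter Topology MeasureTheory

/-- Primitives of the problem: the arrival rate `lam` of the doing arm when it is good, the arrival
rate `mu` of the thinking arm, the payoff `B` of a solution, the flow cost `c` of effort, the prior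
belief `pbar` that the doing arm is good, and the value `V τ` of progress that occurs with time `τ`
remaining to the deadline. -/
structure ThinkDo where
  lam : ℝ
  mu : ℝ
  B : ℝ
  c : ℝ
  pbar : ℝ
  V : ℝ → ℝ

namespace ThinkDo

/-- Standing assumptions on the primitives. Derivatives are taken at `τ > 0`, where `deriv` is the
derivative of `V` on its domain `[0, ∞)`; since `V` is `C³` up to `0`, both conditions then hold
for the one-sided derivatives at `0` as well. -/
structure Standing (M : ThinkDo) : Prop where
  lam_pos : 0 < M.lam
  mu_pos : 0 < M.mu
  B_pos : 0 < M.B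
  c_nonneg : 0 ≤ M.c
  pbar_pos : 0 < M.pbar
  pbar_lt_one : M.pbar < 1
  V_smooth : ContDiffOn ℝ 3 M.V (Ici 0)
  V_increasing : ∀ τ, 0 < τ → 0 < deriv M.V τ
  V_concave : ∀ τ, 0 < τ → M.pbar * M.lam ≤ -deriv (deriv M.V) τ / deriv M.V τ
  V_zero : M.V 0 = 0
  V_infty : ∃ v, Tendsto M.V atTop (𝓝 v) ∧ M.c / M.mu < v

/-- Admissible effort paths. `a τ` is the share of effort on the doing arm with time `τ` remaining
(absent an arrival), and `1 - a τ` is the share on the thinking arm. -/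
def Admissible (T : ℝ) (a : ℝ → ℝ) : Prop :=
  AEMeasurable a (volume.restrict (Icc 0 T)) ∧ ∀ τ ∈ Icc 0 T, a τ ∈ Icc (0 : ℝ) 1

/-- Past effort `A_τ` on the doing arm when time `τ` remains. -/
noncomputable def pastEffort (T : ℝ) (a : ℝ → ℝ) (τ : ℝ) : ℝ :=
  ∫ s in τ..T, a s

/-- Belief `p_τ` that the doing arm is good after unsuccessful past effort `A`. -/
noncomputable def belief (M : ThinkDo) (A : ℝ) : ℝ :=
  M.pbar * Real.exp (-M.lam * A) / (M.pbar * Real.exp (-M.lam * A) + (1 - M.pbar))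

/-- Expected flow payoff with time `τ` remaining, past effort `A` and current action `x`. -/
noncomputable def flow (M : ThinkDo) (τ A x : ℝ) : ℝ :=
  M.mu * (1 - x) * M.V τ + M.lam * x * M.belief A * M.B - M.c

/-- The agent's objective: the flow payoff, weighted by the probabilities of no progress yet and of
no solution yet. -/
noncomputable def payoff (M : ThinkDo) (T : ℝ) (a : ℝ → ℝ) : ℝ :=
  ∫ τ in (0 : ℝ)..T,
    Real.exp (-M.mu * (T - τ - pastEffort T a τ)) *
      (1 - M.pbar + M.pbar * Real.exp (-M.lam * pastEffort T a τ)) *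
      M.flow τ (pastEffort T a τ) (a τ)

/-- `a` is an optimal effort path for the deadline `T`. -/
def IsOptimal (M : ThinkDo) (T : ℝ) (a : ℝ → ℝ) : Prop :=
  Admissible T a ∧ ∀ b, Admissible T b → M.payoff T b ≤ M.payoff T a

/-- The co-state `η_τ` along the path `a`: `η_0 = 0`, and its derivative in `τ` is the derivative of
the survival-weighted flow payoff with respect to past effort `A`. -/
noncomputable def costate (M : ThinkDo) (T : ℝ) (a : ℝ → ℝ) (τ : ℝ) : ℝ :=
  ∫ s in (0 : ℝ)..τ,
    Real.exp (-M.mu * (T - s - pastEffort T a s)) *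
      (M.mu * (1 - M.pbar) * ((1 - a s) * M.mu * M.V s - M.c) -
        (M.lam - M.mu) * Real.exp (-M.lam * pastEffort T a s) * M.pbar *
          ((1 - a s) * M.mu * M.V s + a s * M.lam * M.B - M.c))

/-- The agent's relative preference `γ_τ` for thinking over doing, with time `τ` remaining. -/
noncomputable def relPref (M : ThinkDo) (T : ℝ) (a : ℝ → ℝ) (τ : ℝ) : ℝ :=
  Real.exp (-M.mu * (T - τ - pastEffort T a τ)) *
      ((1 - M.pbar + M.pbar * Real.exp (-M.lam * pastEffort T a τ)) * M.mu * M.V τ -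
        M.pbar * Real.exp (-M.lam * pastEffort T a τ) * M.lam * M.B) -
    M.costate T a τ

/-- The agent thinks until time `s` remains, and does from then on. Effort paths matter only up to
null sets. -/
def ThinkThenDo (T s : ℝ) (a : ℝ → ℝ) : Prop :=
  (∀ᵐ τ, τ ∈ Ioo s T → a τ = 0) ∧ (∀ᵐ τ, τ ∈ Ioo 0 s → a τ = 1)

/-- The agent works on the doing arm throughout. -/
def DoThroughout (T : ℝ) (a : ℝ → ℝ) : Prop :=
  ∀ᵐ τ, τ ∈ Ioo 0 T → a τ = 1

/-- The agent thinks during an initial period of positive length. -/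
def StartsThinking (T : ℝ) (a : ℝ → ℝ) : Prop :=
  ∃ s ∈ Ico 0 T, ∀ᵐ τ, τ ∈ Ioo s T → a τ = 0

/-- The equation that determines the remaining time at the switch. -/
def SwitchEq (M : ThinkDo) (τ : ℝ) : Prop :=
  M.pbar = M.mu * M.V τ / (M.B * (M.mu + (M.lam - M.mu) * Real.exp (-M.lam * τ)))

end ThinkDo

namespace ThinkDo

/-! ### The value of progress -/

namespace Standing

/-! The argument is an exchange argument followed by a one-variable problem. Concavity of `V` and `V
→ B` make the shortfall `B - V` decay at rate at least `pbar * lam`. Failed doing for an amount `A`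
leaves survival probability `1 - pbar + pbar * exp (-lam * A)`, which by Jensen exceeds `exp (-(pbar
* lam * A))`. So once some doing has taken place, thinking comes too late: it would have paid more
before that doing (`delayGain_neg`).

To use this for an arbitrary measurable policy, compare it with a potential: the value of performing
the thinking and doing accumulated so far in the order think, then do. The potential is zero at the
outset, and differentiating it along the path leaves the flow payoff and the loss from misordering.
Hence the payoff equals that of the think-then-do policy with the same total effort plus a
nonpositive integral (`Standing.payoff_eq`), which vanishes only if the policy itself switches once.

It remains to choose the switching time `s`. The derivative of the payoff in `s` has the sign of
`switchGain s`, whose zeros are the solutions of the switching equation. The same decay estimate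
makes it cross zero exactly once, from above, at some `r`; the optimum is `min r T`
(`Standing.isOptimal_iff`).

The sign of the relative preference at the outset is read off from the explicit co-state: it is at
least `0` if `r ≤ T`, and equals `-switchGain T < 0` if `T < r`. -/

theorem hasDerivAt_V {M : ThinkDo} (hM : M.Standing) {τ : ℝ} (hτ : 0 < τ) :
    HasDerivAt M.V (deriv M.V τ) τ :=
  ((hM.V_smooth.contDiffAt (Ici_mem_nhds hτ)).differentiableAt (by norm_num)).hasDerivAt

theorem hasDerivAt_deriv_V {M : ThinkDo} (hM : M.Standing) {τ : ℝ} (hτ : 0 < τ) :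
    HasDerivAt (deriv M.V) (deriv (deriv M.V) τ) τ := by
  have h : ContDiffOn ℝ 1 (deriv M.V) (Ioi 0) :=
    (hM.V_smooth.mono Ioi_subset_Ici_self).deriv_of_isOpen isOpen_Ioi (by norm_num)
  exact ((h.contDiffAt (Ioi_mem_nhds hτ)).differentiableAt (by norm_num)).hasDerivAt

theorem continuousOn_V {M : ThinkDo} (hM : M.Standing) : ContinuousOn M.V (Ici 0) :=
  hM.V_smooth.continuousOn

theorem strictMonoOn_V {M : ThinkDo} (hM : M.Standing) : StrictMonoOn M.V (Ici 0) := by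
  refine strictMonoOn_of_deriv_pos (convex_Ici 0) hM.continuousOn_V fun x hx => ?_
  rw [interior_Ici] at hx
  exact hM.V_increasing x hx

theorem V_lt_B {M : ThinkDo} (hM : M.Standing) (hV : Tendsto M.V atTop (𝓝 M.B)) {τ : ℝ}
    (hτ : 0 ≤ τ) : M.V τ < M.B := by
  refine (hM.strictMonoOn_V (mem_Ici.2 hτ) (mem_Ici.2 (by linarith : 0 ≤ τ + 1))
    (lt_add_one τ)).trans_le ?_
  refine ge_of_tendsto hV ?_
  filter_upwards [eventually_ge_atTop (τ + 1)] with x hx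
  exact hM.strictMonoOn_V.monotoneOn (mem_Ici.2 (by linarith : 0 ≤ τ + 1))
    (mem_Ici.2 (by linarith : 0 ≤ x)) hx

/-- Concavity of `V` bounds its slope below by the shortfall of `V` from its limit. -/
theorem shortfall_le_deriv {M : ThinkDo} (hM : M.Standing) (hV : Tendsto M.V atTop (𝓝 M.B))
    {τ : ℝ} (hτ : 0 < τ) : M.pbar * M.lam * (M.B - M.V τ) ≤ deriv M.V τ := by
  have hd : ∀ x, 0 < x → HasDerivAt (fun x => deriv M.V x + M.pbar * M.lam * M.V x)
      (deriv (deriv M.V) x + M.pbar * M.lam * deriv M.V x) x := fun x hx =>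
    (hM.hasDerivAt_deriv_V hx).add ((hM.hasDerivAt_V hx).const_mul _)
  have hanti : AntitoneOn (fun x => deriv M.V x + M.pbar * M.lam * M.V x) (Ioi 0) := by
    refine antitoneOn_of_deriv_nonpos (convex_Ioi 0)
      (fun x hx => (hd x hx).continuousAt.continuousWithinAt) ?_ ?_ <;> rw [interior_Ioi]
    · exact fun x hx => (hd x hx).differentiableAt.differentiableWithinAt
    · intro x hx
      rw [(hd x hx).deriv]
      have := (le_div_iff₀ (hM.V_increasing x hx)).1 (hM.V_concave x hx)
      linarith
  have hlim : Tendsto (fun x => M.pbar * M.lam * M.V x) atTop (𝓝 (M.pbar * M.lam * M.B)) :=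
    hV.const_mul _
  -- The antitone quantity stays above `pbar * lam * V` because `deriv V > 0`; no limit of `deriv V`
  -- is needed.
  have hle : M.pbar * M.lam * M.B ≤ deriv M.V τ + M.pbar * M.lam * M.V τ := by
    refine le_of_tendsto hlim ?_
    filter_upwards [eventually_ge_atTop τ] with x hx
    have h1 := hanti (mem_Ioi.2 hτ) (mem_Ioi.2 (hτ.trans_le hx)) hx
    have h2 := hM.V_increasing x (hτ.trans_le hx)
    simp only at h1
    linarith
  linarith

/-- Gronwall: `shortfall_le_deriv` says that the shortfall times `exp (pbar * lam * x)` does not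
increase. -/
theorem shortfall_add_le {M : ThinkDo} (hM : M.Standing) (hV : Tendsto M.V atTop (𝓝 M.B))
    {τ A : ℝ} (hτ : 0 ≤ τ) (hA : 0 ≤ A) :
    M.B - M.V (τ + A) ≤ Real.exp (-(M.pbar * M.lam * A)) * (M.B - M.V τ) := by
  have hd : ∀ x, 0 < x → HasDerivAt (fun x => Real.exp (M.pbar * M.lam * x) * (M.B - M.V x))
      (Real.exp (M.pbar * M.lam * x) * (M.pbar * M.lam * 1) * (M.B - M.V x) +
        Real.exp (M.pbar * M.lam * x) * (0 - deriv M.V x)) x := fun x hx =>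
    (((hasDerivAt_id x).const_mul (M.pbar * M.lam)).exp).mul
      ((hasDerivAt_const x M.B).sub (hM.hasDerivAt_V hx))
  have hanti : AntitoneOn (fun x => Real.exp (M.pbar * M.lam * x) * (M.B - M.V x)) (Ici 0) := by
    refine antitoneOn_of_deriv_nonpos (convex_Ici 0) ?_ ?_ ?_
    · exact (Continuous.continuousOn (by fun_prop)).mul (continuousOn_const.sub hM.continuousOn_V)
    · rw [interior_Ici]
      exact fun x hx => (hd x hx).differentiableAt.differentiableWithinAt
    · rw [interior_Ici]
      intro x hx
      rw [(hd x hx).deriv]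
      have h1 := hM.shortfall_le_deriv hV hx
      have h2 := Real.exp_pos (M.pbar * M.lam * x)
      nlinarith
  have h := hanti (mem_Ici.2 hτ) (mem_Ici.2 (by linarith : 0 ≤ τ + A)) (by linarith)
  simp only [mul_add, Real.exp_add] at h
  rw [mul_assoc] at h
  have h' := le_of_mul_le_mul_left h (Real.exp_pos _)
  rw [Real.exp_neg, ← div_eq_inv_mul, le_div_iff₀ (Real.exp_pos _)]
  linarith

/-- Strict Jensen for `exp` at the points `0` and `-lam * A` with weights `1 - pbar` and `pbar`. -/
theorem exp_lt_survival {M : ThinkDo} (hM : M.Standing) {A : ℝ} (hA : 0 < A) :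
    Real.exp (-(M.pbar * M.lam * A)) < 1 - M.pbar + M.pbar * Real.exp (-M.lam * A) := by
  have h := strictConvexOn_exp.2 (mem_univ (0 : ℝ)) (mem_univ (-M.lam * A))
    (by have := mul_pos hM.lam_pos hA; linarith) (sub_pos.2 hM.pbar_lt_one) hM.pbar_pos
    (by ring)
  simp only [smul_eq_mul, mul_zero, zero_add, Real.exp_zero, mul_one] at h
  rwa [show M.pbar * (-M.lam * A) = -(M.pbar * M.lam * A) by ring] at h

end Standing

/-- What thinking at remaining time `τ`, after effort `A` on doing, gains over having thought when
time `τ + A` remained. -/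
noncomputable def delayGain (M : ThinkDo) (τ A : ℝ) : ℝ :=
  M.B - M.V (τ + A) - (1 - M.pbar + M.pbar * Real.exp (-M.lam * A)) * (M.B - M.V τ)

theorem delayGain_zero (M : ThinkDo) (τ : ℝ) : M.delayGain τ 0 = 0 := by
  simp [delayGain]

theorem Standing.delayGain_neg {M : ThinkDo} (hM : M.Standing)
    (hV : Tendsto M.V atTop (𝓝 M.B)) {τ A : ℝ} (hτ : 0 ≤ τ) (hA : 0 < A) :
    M.delayGain τ A < 0 := by
  have h1 := hM.shortfall_add_le hV hτ hA.le
  have h2 := mul_lt_mul_of_pos_right (hM.exp_lt_survival hA) (sub_pos.2 (hM.V_lt_B hV hτ))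
  unfold delayGain
  linarith

theorem Standing.delayGain_nonpos {M : ThinkDo} (hM : M.Standing)
    (hV : Tendsto M.V atTop (𝓝 M.B)) {τ A : ℝ} (hτ : 0 ≤ τ) (hA : 0 ≤ A) :
    M.delayGain τ A ≤ 0 := by
  rcases hA.eq_or_lt with rfl | hA
  · exact (M.delayGain_zero τ).le
  · exact (hM.delayGain_neg hV hτ hA).le

/-! ### The switching equation -/

/-- The marginal gain from doing rather than thinking when time `s` remains, if doing is done
throughout the remaining time. -/
noncomputable def switchGain (M : ThinkDo) (s : ℝ) : ℝ :=
  M.B * M.pbar * (M.mu + (M.lam - M.mu) * Real.exp (-M.lam * s)) - M.mu * M.V s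

theorem Standing.switch_denom_pos {M : ThinkDo} (hM : M.Standing) {s : ℝ} (hs : 0 ≤ s) :
    0 < M.mu + (M.lam - M.mu) * Real.exp (-M.lam * s) := by
  have h0 := Real.exp_pos (-M.lam * s)
  have h1 : Real.exp (-M.lam * s) ≤ 1 := Real.exp_le_one_iff.2 (by nlinarith [hM.lam_pos])
  nlinarith [hM.lam_pos, hM.mu_pos, mul_pos hM.lam_pos h0]

theorem Standing.switchEq_iff {M : ThinkDo} (hM : M.Standing) {s : ℝ} (hs : 0 ≤ s) :
    M.SwitchEq s ↔ M.switchGain s = 0 := by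
  have h := hM.switch_denom_pos hs
  unfold SwitchEq switchGain
  rw [eq_div_iff (mul_pos hM.B_pos h).ne', sub_eq_zero]
  constructor <;> intro h <;> linarith

/-- `switchGain` itself need not be monotone; the integrating factor matches the decay rate of the
shortfall, so that the terms in `V` cancel against the bound on `deriv V`. -/
theorem Standing.strictAntiOn_exp_mul_switchGain {M : ThinkDo} (hM : M.Standing)
    (hV : Tendsto M.V atTop (𝓝 M.B)) :
    StrictAntiOn (fun s => Real.exp (M.pbar * M.lam * s) * M.switchGain s) (Ici 0) := by
  have hd : ∀ x, 0 < x → HasDerivAt (fun s => Real.exp (M.pbar * M.lam * s) * M.switchGain s)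
      (Real.exp (M.pbar * M.lam * x) * (M.pbar * M.lam * 1) * M.switchGain x +
        Real.exp (M.pbar * M.lam * x) * (M.B * M.pbar * ((M.lam - M.mu) *
          (Real.exp (-M.lam * x) * (-M.lam * 1))) - M.mu * deriv M.V x)) x := fun x hx =>
    (((hasDerivAt_id x).const_mul (M.pbar * M.lam)).exp).mul
      ((((((hasDerivAt_id x).const_mul (-M.lam)).exp.const_mul _).const_add _).const_mul _).sub
        ((hM.hasDerivAt_V hx).const_mul _))
  refine strictAntiOn_of_deriv_neg (convex_Ici 0) ?_ ?_
  · refine (Continuous.continuousOn (by fun_prop)).mul ?_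
    exact (Continuous.continuousOn (by fun_prop)).sub (continuousOn_const.mul hM.continuousOn_V)
  · rw [interior_Ici]
    intro x hx
    rw [(hd x hx).deriv, mul_assoc, ← mul_add]
    refine mul_neg_of_pos_of_neg (Real.exp_pos _) ?_
    have h1 := mul_le_mul_of_nonneg_left (hM.shortfall_le_deriv hV hx) hM.mu_pos.le
    -- After that cancellation, the bound on the derivative is minus this product.
    have h2 : 0 < M.lam * M.B * M.pbar * (1 - M.pbar) *
        (M.mu + (M.lam - M.mu) * Real.exp (-M.lam * x)) := by
      have := hM.switch_denom_pos (le_of_lt hx)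
      have := hM.lam_pos
      have := hM.B_pos
      have := hM.pbar_pos
      have := sub_pos.2 hM.pbar_lt_one
      positivity
    unfold switchGain
    linarith

/-- Intermediate values: the gain is `B * pbar * lam` at `0` and tends to `-(1 - pbar) * mu * B`. -/
theorem Standing.exists_switchGain_eq_zero {M : ThinkDo} (hM : M.Standing)
    (hV : Tendsto M.V atTop (𝓝 M.B)) : ∃ s, 0 < s ∧ M.switchGain s = 0 := by
  have hexp : Tendsto (fun s => Real.exp (-M.lam * s)) atTop (𝓝 0) := by
    refine Real.tendsto_exp_atBot.comp ?_
    exact tendsto_id.const_mul_atTop_of_neg (neg_lt_zero.2 hM.lam_pos)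
  have hlim : Tendsto M.switchGain atTop
      (𝓝 (M.B * M.pbar * (M.mu + (M.lam - M.mu) * 0) - M.mu * M.B)) :=
    (((hexp.const_mul _).const_add _).const_mul _).sub (hV.const_mul _)
  have hneg : M.B * M.pbar * (M.mu + (M.lam - M.mu) * 0) - M.mu * M.B < 0 := by
    have := mul_pos (mul_pos hM.B_pos hM.mu_pos) (sub_pos.2 hM.pbar_lt_one)
    linarith
  obtain ⟨t, ht, ht0⟩ := ((hlim.eventually_lt_const hneg).and (eventually_gt_atTop 0)).exists
  have h0 : 0 < M.switchGain 0 := by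
    have := mul_pos (mul_pos hM.B_pos hM.pbar_pos) hM.lam_pos
    simp only [switchGain, mul_zero, Real.exp_zero, hM.V_zero]
    linarith
  have hcont : ContinuousOn M.switchGain (Icc 0 t) := by
    refine ContinuousOn.mono (s := Ici 0) ?_ Icc_subset_Ici_self
    exact (Continuous.continuousOn (by fun_prop)).sub (continuousOn_const.mul hM.continuousOn_V)
  obtain ⟨s, hs, hs0⟩ := intermediate_value_Icc' ht0.le hcont ⟨ht.le, h0.le⟩
  refine ⟨s, hs.1.lt_of_ne fun h => ?_, hs0⟩
  rw [← h] at hs0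
  exact h0.ne' hs0

/-- The switching gain changes sign exactly once. -/
theorem Standing.exists_switch {M : ThinkDo} (hM : M.Standing)
    (hV : Tendsto M.V atTop (𝓝 M.B)) :
    ∃ r, 0 < r ∧ M.switchGain r = 0 ∧ (∀ s, 0 ≤ s → s < r → 0 < M.switchGain s) ∧
      ∀ s, r < s → M.switchGain s < 0 := by
  obtain ⟨r, hr, hr0⟩ := hM.exists_switchGain_eq_zero hV
  have hanti := hM.strictAntiOn_exp_mul_switchGain hV
  refine ⟨r, hr, hr0, fun s hs hsr => ?_, fun s hrs => ?_⟩
  · have h := hanti (mem_Ici.2 hs) (mem_Ici.2 hr.le) hsr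
    simp only [hr0, mul_zero] at h
    exact pos_of_mul_pos_right h (Real.exp_pos _).le
  · have h := hanti (mem_Ici.2 hr.le) (mem_Ici.2 (hr.trans hrs).le) hrs
    simp only [hr0, mul_zero] at h
    exact neg_of_mul_neg_right h (Real.exp_pos _).le

end ThinkDo

/-! ### Absolutely continuous functions -/

theorem ContDiff.comp_absolutelyContinuousOnInterval {h f : ℝ → ℝ} {K : NNReal} {a b : ℝ}
    (hh : ContDiff ℝ 1 h) (hf : LipschitzOnWith K f (uIcc a b)) :
    AbsolutelyContinuousOnInterval (fun x => h (f x)) a b := by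
  obtain ⟨L, hL⟩ := (hh.locallyLipschitz.locallyLipschitzOn
    (s := f '' uIcc a b)).exists_lipschitzOnWith_of_compact
      (isCompact_uIcc.image_of_continuousOn hf.continuousOn)
  exact (hL.comp hf (mapsTo_image f _)).absolutelyContinuousOnInterval

/-- Policies are merely measurable, so the potential is differentiable only almost everywhere along
a path; absolute continuity restores the fundamental theorem of calculus. -/
theorem AbsolutelyContinuousOnInterval.integrable_and_integral_eq_sub {f f' : ℝ → ℝ} {a b : ℝ}
    (hf : AbsolutelyContinuousOnInterval f a b)
    (hf' : ∀ᵐ x, x ∈ uIoc a b → HasDerivAt f (f' x) x) :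
    IntervalIntegrable f' volume a b ∧ ∫ x in a..b, f' x = f b - f a := by
  have h : ∀ᵐ x, x ∈ uIoc a b → deriv f x = f' x := by
    filter_upwards [hf'] with x hx hxm
    exact (hx hxm).deriv
  refine ⟨hf.intervalIntegrable_deriv.congr_ae ?_, ?_⟩
  · exact (ae_restrict_iff' measurableSet_uIoc).2 h
  · rw [← hf.integral_deriv_eq_sub]
    exact (intervalIntegral.integral_congr_ae h).symm

namespace ThinkDo

/-! ### Past effort -/

namespace Admissible

theorem integrableOn {T : ℝ} {a : ℝ → ℝ} (ha : Admissible T a) :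
    IntegrableOn a (Icc 0 T) := by
  refine Integrable.of_mem_Icc 0 1 ha.1 ?_
  filter_upwards [ae_restrict_mem measurableSet_Icc] with x hx using ha.2 x hx

theorem intervalIntegrable {T : ℝ} {a : ℝ → ℝ} (ha : Admissible T a) {σ τ : ℝ}
    (hσ : σ ∈ Icc 0 T) (hτ : τ ∈ Icc 0 T) : IntervalIntegrable a volume σ τ :=
  (ha.integrableOn.mono_set (uIcc_subset_Icc hσ hτ)).intervalIntegrable

theorem pastEffort_eq_add {T : ℝ} {a : ℝ → ℝ} (ha : Admissible T a) {σ τ : ℝ}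
    (hσ : σ ∈ Icc 0 T) (hτ : τ ∈ Icc 0 T) :
    pastEffort T a σ = (∫ s in σ..τ, a s) + pastEffort T a τ :=
  (intervalIntegral.integral_add_adjacent_intervals (ha.intervalIntegrable hσ hτ)
    (ha.intervalIntegrable hτ ⟨hτ.1.trans hτ.2, le_rfl⟩)).symm

theorem integral_mem_Icc {T : ℝ} {a : ℝ → ℝ} (ha : Admissible T a) {σ τ : ℝ}
    (hσ : σ ∈ Icc 0 T) (hτ : τ ∈ Icc 0 T) (h : σ ≤ τ) :
    ∫ s in σ..τ, a s ∈ Icc 0 (τ - σ) := by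
  constructor
  · exact intervalIntegral.integral_nonneg h fun s hs =>
      (ha.2 s ⟨hσ.1.trans hs.1, hs.2.trans hτ.2⟩).1
  · have := intervalIntegral.integral_mono_on h (ha.intervalIntegrable hσ hτ)
      (intervalIntegrable_const (c := (1 : ℝ))) fun s hs =>
        (ha.2 s ⟨hσ.1.trans hs.1, hs.2.trans hτ.2⟩).2
    simpa using this

theorem lipschitzOnWith_pastEffort {T : ℝ} {a : ℝ → ℝ} (ha : Admissible T a) :
    LipschitzOnWith 1 (pastEffort T a) (Icc 0 T) := by
  refine LipschitzOnWith.of_dist_le_mul fun σ hσ τ hτ => ?_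
  rw [NNReal.coe_one, one_mul]
  wlog h : σ ≤ τ generalizing σ τ
  · rw [dist_comm, dist_comm σ]
    exact this τ hτ σ hσ (le_of_not_ge h)
  have h1 := ha.pastEffort_eq_add hσ hτ
  have h2 := ha.integral_mem_Icc hσ hτ h
  rw [Real.dist_eq, dist_comm, Real.dist_eq, abs_of_nonneg (sub_nonneg.2 h), abs_of_nonneg]
  · linarith [h2.2]
  · linarith [h2.1]

theorem pastEffort_mem_Icc {T : ℝ} {a : ℝ → ℝ} (ha : Admissible T a) {τ : ℝ}
    (hτ : τ ∈ Icc 0 T) : pastEffort T a τ ∈ Icc 0 (T - τ) :=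
  ha.integral_mem_Icc hτ ⟨hτ.1.trans hτ.2, le_rfl⟩ hτ.2

theorem ae_hasDerivAt_pastEffort {T : ℝ} {a : ℝ → ℝ} (hT : 0 ≤ T) (ha : Admissible T a) :
    ∀ᵐ τ, τ ∈ Icc 0 T → HasDerivAt (pastEffort T a) (-a τ) τ := by
  have h := (ha.intervalIntegrable (left_mem_Icc.2 hT)
    (right_mem_Icc.2 hT)).ae_hasDerivAt_integral
  rw [uIcc_of_le hT] at h
  filter_upwards [h] with τ hτ hm
  refine (hτ hm T (right_mem_Icc.2 hT)).neg.congr_of_eventuallyEq (Eventually.of_forall fun x => ?_)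
  exact intervalIntegral.integral_symm T x

end Admissible

theorem pastEffort_self (T : ℝ) (a : ℝ → ℝ) : pastEffort T a T = 0 :=
  intervalIntegral.integral_same

/-! ### The payoff as a potential plus a loss -/

/-- `V`, extended to the left of `0` by its value at `0`. -/
noncomputable def extV (M : ThinkDo) (τ : ℝ) : ℝ := M.V (max τ 0)

theorem extV_of_nonneg (M : ThinkDo) {τ : ℝ} (hτ : 0 ≤ τ) : M.extV τ = M.V τ := by
  rw [extV, max_eq_left hτ]

theorem Standing.continuous_extV {M : ThinkDo} (hM : M.Standing) : Continuous M.extV :=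
  hM.continuousOn_V.comp_continuous (by fun_prop) fun x => le_max_right x 0

/-- The payoff from thinking for an amount of time `m` at the outset. -/
noncomputable def thinkValue (M : ThinkDo) (T m : ℝ) : ℝ :=
  ∫ x in (0 : ℝ)..m, Real.exp (-M.mu * x) * (M.mu * M.extV (T - x))

theorem Standing.continuous_thinkRate {M : ThinkDo} (hM : M.Standing) (T : ℝ) :
    Continuous fun x => Real.exp (-M.mu * x) * (M.mu * M.extV (T - x)) := by
  have h := hM.continuous_extV
  fun_prop

theorem Standing.hasDerivAt_thinkValue {M : ThinkDo} (hM : M.Standing) (T m : ℝ) :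
    HasDerivAt (M.thinkValue T) (Real.exp (-M.mu * m) * (M.mu * M.extV (T - m))) m :=
  ((hM.continuous_thinkRate T).integral_hasStrictDerivAt 0 m).hasDerivAt

/-- Extending `V` to negative times gives smoothness on the whole line, as needed for composing with
a Lipschitz path. -/
theorem Standing.contDiff_thinkValue {M : ThinkDo} (hM : M.Standing) (T : ℝ) :
    ContDiff ℝ 1 (M.thinkValue T) := by
  refine contDiff_one_iff_deriv.2
    ⟨fun m => (hM.hasDerivAt_thinkValue T m).differentiableAt, ?_⟩
  rw [show deriv (M.thinkValue T) = _ from funext fun m => (hM.hasDerivAt_thinkValue T m).deriv]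
  exact hM.continuous_thinkRate T

/-- The payoff from thinking for an amount of time `m` first and doing for an amount of time `A`
thereafter. -/
noncomputable def potential (M : ThinkDo) (T A m : ℝ) : ℝ :=
  M.thinkValue T m +
    Real.exp (-M.mu * m) * (M.pbar * (1 - Real.exp (-M.lam * A)) * M.B)

/-- The rate at which a policy loses payoff relative to moving all thinking to the outset. -/
noncomputable def lossRate (M : ThinkDo) (T : ℝ) (a : ℝ → ℝ) (τ : ℝ) : ℝ :=
  (1 - a τ) * (M.mu * Real.exp (-M.mu * (T - τ - pastEffort T a τ)) *
    M.delayGain τ (pastEffort T a τ))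

theorem Standing.intervalIntegrable_lossRate {M : ThinkDo} (hM : M.Standing) {T : ℝ} (hT : 0 ≤ T)
    {a : ℝ → ℝ} (ha : Admissible T a) : IntervalIntegrable (M.lossRate T a) volume 0 T := by
  have hA : ContinuousOn (pastEffort T a) (Icc 0 T) := ha.lipschitzOnWith_pastEffort.continuousOn
  have hV1 : ContinuousOn M.V (Icc 0 T) := hM.continuousOn_V.mono Icc_subset_Ici_self
  have hV2 : ContinuousOn (fun τ => M.V (τ + pastEffort T a τ)) (Icc 0 T) :=
    hM.continuousOn_V.comp (continuousOn_id.add hA) fun τ hτ =>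
      add_nonneg hτ.1 (ha.pastEffort_mem_Icc hτ).1
  refine (intervalIntegrable_const.sub (ha.intervalIntegrable (left_mem_Icc.2 hT)
    (right_mem_Icc.2 hT))).mul_continuousOn ?_
  rw [uIcc_of_le hT]
  unfold delayGain
  fun_prop

theorem Standing.survival_mul_flow {M : ThinkDo} (hM : M.Standing) (hc : M.c = 0) (τ A x : ℝ) :
    (1 - M.pbar + M.pbar * Real.exp (-M.lam * A)) * M.flow τ A x =
      (1 - M.pbar + M.pbar * Real.exp (-M.lam * A)) * (M.mu * (1 - x) * M.V τ) +
        M.lam * x * (M.pbar * Real.exp (-M.lam * A)) * M.B := by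
  have hq : M.pbar * Real.exp (-M.lam * A) + (1 - M.pbar) ≠ 0 := by
    have := mul_pos hM.pbar_pos (Real.exp_pos (-M.lam * A))
    linarith [hM.pbar_lt_one]
  have hb : (1 - M.pbar + M.pbar * Real.exp (-M.lam * A)) * M.belief A =
      M.pbar * Real.exp (-M.lam * A) := by
    rw [add_comm, belief, mul_div_cancel₀ _ hq]
  rw [flow, hc]
  linear_combination M.lam * x * M.B * hb

theorem Standing.payoff_eq {M : ThinkDo} (hM : M.Standing) (hc : M.c = 0) {T : ℝ} (hT : 0 ≤ T)
    {a : ℝ → ℝ} (ha : Admissible T a) :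
    M.payoff T a = M.potential T (pastEffort T a 0) (T - pastEffort T a 0) +
      ∫ τ in (0 : ℝ)..T, M.lossRate T a τ := by
  have hA : LipschitzOnWith 1 (pastEffort T a) (uIcc 0 T) := by
    rw [uIcc_of_le hT]
    exact ha.lipschitzOnWith_pastEffort
  obtain ⟨K, hm⟩ : ∃ K, LipschitzOnWith K (fun τ => T - τ - pastEffort T a τ) (uIcc 0 T) :=
    ⟨_, (((LipschitzWith.const T).sub LipschitzWith.id).lipschitzOnWith).sub hA⟩
  have hAC : AbsolutelyContinuousOnInterval
      (fun τ => M.potential T (pastEffort T a τ) (T - τ - pastEffort T a τ)) 0 T := by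
    have h1 : ContDiff ℝ 1 fun m => Real.exp (-M.mu * m) := by fun_prop
    have h2 : ContDiff ℝ 1 fun A => M.pbar * (1 - Real.exp (-M.lam * A)) * M.B := by fun_prop
    exact ((hM.contDiff_thinkValue T).comp_absolutelyContinuousOnInterval hm).add
      ((h1.comp_absolutelyContinuousOnInterval hm).fun_mul
        (h2.comp_absolutelyContinuousOnInterval hA))
  have hderiv : ∀ᵐ τ, τ ∈ uIoc 0 T → HasDerivAt
      (fun τ => M.potential T (pastEffort T a τ) (T - τ - pastEffort T a τ))
      (M.lossRate T a τ - Real.exp (-M.mu * (T - τ - pastEffort T a τ)) *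
        (1 - M.pbar + M.pbar * Real.exp (-M.lam * pastEffort T a τ)) *
        M.flow τ (pastEffort T a τ) (a τ)) τ := by
    filter_upwards [ha.ae_hasDerivAt_pastEffort hT] with τ hτ hmem
    rw [uIoc_of_le hT] at hmem
    have hmem' : τ ∈ Icc 0 T := Ioc_subset_Icc_self hmem
    have hdA := hτ hmem'
    have hdm := ((hasDerivAt_id τ).const_sub T).sub hdA
    have hd := ((hM.hasDerivAt_thinkValue T _).comp τ hdm).add
      ((hdm.const_mul (-M.mu)).exp.mul
        ((((hdA.const_mul (-M.lam)).exp.const_sub 1).const_mul M.pbar).mul_const M.B))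
    have hA0 := (ha.pastEffort_mem_Icc hmem').1
    -- Had all past thinking come first, time `τ + A` would remain when it ended.
    have hV : M.extV (T - (T - τ - pastEffort T a τ)) = M.V (τ + pastEffort T a τ) := by
      rw [show T - (T - τ - pastEffort T a τ) = τ + pastEffort T a τ by ring]
      exact M.extV_of_nonneg (add_nonneg hmem'.1 hA0)
    refine hd.congr_deriv ?_
    rw [mul_assoc _ (1 - M.pbar + _), hM.survival_mul_flow hc]
    simp only [Pi.sub_apply, id_eq, hV, lossRate, delayGain]
    ring
  obtain ⟨hint, heq⟩ := hAC.integrable_and_integral_eq_sub hderiv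
  have hloss := hM.intervalIntegrable_lossRate hT ha
  -- The flow payoff is the loss rate minus the derivative of the potential, so its integrability
  -- comes for free.
  have hsub := intervalIntegral.integral_sub hloss hint
  simp only [sub_sub_cancel] at hsub
  rw [payoff, hsub, heq, pastEffort_self]
  simp [potential, thinkValue]
  ring

/-! ### Policies that switch once -/

/-- The payoff from thinking until time `s` remains and doing from then on. -/
noncomputable def switchPayoff (M : ThinkDo) (T s : ℝ) : ℝ :=
  M.potential T s (T - s)

theorem Standing.hasDerivAt_switchPayoff {M : ThinkDo} (hM : M.Standing) (T : ℝ) {s : ℝ}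
    (hs : 0 ≤ s) :
    HasDerivAt (M.switchPayoff T) (Real.exp (-M.mu * (T - s)) * M.switchGain s) s := by
  have hdm := (hasDerivAt_id s).const_sub T
  have hd := ((hM.hasDerivAt_thinkValue T _).comp s hdm).add
    ((hdm.const_mul (-M.mu)).exp.mul
      (((((hasDerivAt_id s).const_mul (-M.lam)).exp.const_sub 1).const_mul M.pbar).mul_const M.B))
  refine hd.congr_deriv ?_
  simp only [id_eq, sub_sub_cancel, M.extV_of_nonneg hs, switchGain]
  ring

theorem Standing.switchPayoff_lt {M : ThinkDo} (hM : M.Standing) {T r s : ℝ} (hr : 0 < r)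
    (hpos : ∀ s, 0 ≤ s → s < r → 0 < M.switchGain s) (hneg : ∀ s, r < s → M.switchGain s < 0)
    (hs : s ∈ Icc 0 T) (hne : s ≠ min r T) :
    M.switchPayoff T s < M.switchPayoff T (min r T) := by
  have hcont : ContinuousOn (M.switchPayoff T) (Ici 0) := fun x hx =>
    (hM.hasDerivAt_switchPayoff T hx).continuousAt.continuousWithinAt
  have hmono : StrictMonoOn (M.switchPayoff T) (Icc 0 r) := by
    refine strictMonoOn_of_deriv_pos (convex_Icc 0 r) (hcont.mono Icc_subset_Ici_self) ?_
    rw [interior_Icc]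
    intro x hx
    rw [(hM.hasDerivAt_switchPayoff T hx.1.le).deriv]
    exact mul_pos (Real.exp_pos _) (hpos x hx.1.le hx.2)
  have hanti : StrictAntiOn (M.switchPayoff T) (Ici r) := by
    refine strictAntiOn_of_deriv_neg (convex_Ici r) (hcont.mono (Ici_subset_Ici.2 hr.le)) ?_
    rw [interior_Ici]
    intro x hx
    rw [(hM.hasDerivAt_switchPayoff T (hr.trans hx).le).deriv]
    exact mul_neg_of_pos_of_neg (Real.exp_pos _) (hneg x hx)
  rcases le_total s r with hsr | hrs
  · have hlt : s < min r T := lt_of_le_of_ne (le_min hsr hs.2) hne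
    exact hmono ⟨hs.1, hsr⟩ ⟨hs.1.trans hlt.le, min_le_left r T⟩ hlt
  · rw [min_eq_left (hrs.trans hs.2)] at hne ⊢
    exact hanti self_mem_Ici hrs (lt_of_le_of_ne hrs hne.symm)

theorem ThinkThenDo.ae_eq {T s : ℝ} {a : ℝ → ℝ} (h : ThinkThenDo T s a) :
    ∀ᵐ τ, (τ ∈ Ioc s T → a τ = 0) ∧ (τ ∈ Ioc 0 s → a τ = 1) := by
  filter_upwards [h.1, h.2, Measure.ae_ne volume s, Measure.ae_ne volume T] with τ h1 h2 h3 h4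
  exact ⟨fun h => h1 ⟨h.1, lt_of_le_of_ne h.2 h4⟩, fun h => h2 ⟨h.1, lt_of_le_of_ne h.2 h3⟩⟩

theorem ThinkThenDo.pastEffort_of_ge {T s τ : ℝ} {a : ℝ → ℝ} (h : ThinkThenDo T s a)
    (hτ : s ≤ τ) (hT : τ ≤ T) : pastEffort T a τ = 0 := by
  rw [pastEffort, intervalIntegral.integral_congr_ae (g := fun _ => (0 : ℝ)),
    intervalIntegral.integral_zero]
  filter_upwards [h.ae_eq] with x hx hm
  rw [uIoc_of_le hT] at hm
  exact hx.1 ⟨hτ.trans_lt hm.1, hm.2⟩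

theorem ThinkThenDo.pastEffort_of_le {T s τ : ℝ} {a : ℝ → ℝ} (ha : Admissible T a)
    (h : ThinkThenDo T s a) (hτ : 0 ≤ τ) (hs : τ ≤ s) (hT : s ≤ T) :
    pastEffort T a τ = s - τ := by
  rw [ha.pastEffort_eq_add ⟨hτ, hs.trans hT⟩ ⟨hτ.trans hs, hT⟩, h.pastEffort_of_ge le_rfl hT,
    intervalIntegral.integral_congr_ae (g := fun _ => (1 : ℝ))]
  · simp
  · filter_upwards [h.ae_eq] with x hx hm
    rw [uIoc_of_le hs] at hm
    exact hx.2 ⟨hτ.trans_lt hm.1, hm.2⟩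

theorem ThinkThenDo.payoff_eq {M : ThinkDo} (hM : M.Standing) (hc : M.c = 0) {T s : ℝ}
    {a : ℝ → ℝ} (ha : Admissible T a) (hs : s ∈ Icc 0 T) (h : ThinkThenDo T s a) :
    M.payoff T a = M.switchPayoff T s := by
  have hT : 0 ≤ T := hs.1.trans hs.2
  rw [hM.payoff_eq hc hT ha, h.pastEffort_of_le ha le_rfl hs.1 hs.2, sub_zero,
    intervalIntegral.integral_congr_ae (g := fun _ => (0 : ℝ)),
    intervalIntegral.integral_zero, add_zero, switchPayoff]
  filter_upwards [h.ae_eq] with τ hτ hm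
  rw [uIoc_of_le hT] at hm
  rcases le_or_gt τ s with hle | hlt
  · simp [lossRate, hτ.2 ⟨hm.1, hle⟩]
  · simp [lossRate, h.pastEffort_of_ge hlt.le hm.2, delayGain_zero]

theorem exists_admissible_thinkThenDo (T s : ℝ) :
    ∃ a, Admissible T a ∧ ThinkThenDo T s a := by
  refine ⟨(Iic s).indicator 1, ⟨(measurable_one.indicator measurableSet_Iic).aemeasurable,
    fun τ _ => ?_⟩, Eventually.of_forall fun τ hτ => ?_, Eventually.of_forall fun τ hτ => ?_⟩
  · by_cases h : τ ∈ Iic s <;> simp [h]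
  · exact indicator_of_notMem (notMem_Iic.2 hτ.1) _
  · exact indicator_of_mem (mem_Iic.2 hτ.2.le) _

/-- A policy that does at full intensity as soon as it has done at all switches once. -/
theorem Admissible.thinkThenDo {T : ℝ} {a : ℝ → ℝ} (hT : 0 ≤ T) (ha : Admissible T a)
    (h : ∀ᵐ τ, τ ∈ Ioc 0 T → pastEffort T a τ = 0 ∨ a τ = 1) :
    ThinkThenDo T (pastEffort T a 0) a := by
  -- The switch is at the least remaining time with zero past effort; closedness ensures that it is
  -- attained.
  have hclosed : IsClosed (Icc 0 T ∩ pastEffort T a ⁻¹' {0}) :=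
    ha.lipschitzOnWith_pastEffort.continuousOn.preimage_isClosed_of_isClosed isClosed_Icc
      isClosed_singleton
  obtain ⟨u, ⟨hu, hu0⟩, hmin⟩ := (isCompact_Icc.of_isClosed_subset hclosed
    inter_subset_left).exists_isLeast ⟨T, right_mem_Icc.2 hT, pastEffort_self T a⟩
  have hdo : ∀ᵐ τ, τ ∈ Ioo 0 u → a τ = 1 := by
    filter_upwards [h] with τ hτ hm
    have hmT : τ ∈ Icc 0 T := ⟨hm.1.le, hm.2.le.trans hu.2⟩
    exact (hτ ⟨hm.1, hmT.2⟩).resolve_left fun h0 => (hmin ⟨hmT, h0⟩).not_gt hm.2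
  have hthink : ∀ᵐ τ, τ ∈ Ioo u T → a τ = 0 := by
    have hnonneg : 0 ≤ᵐ[volume.restrict (Ioc u T)] a := by
      filter_upwards [ae_restrict_mem measurableSet_Ioc] with x hx
      exact (ha.2 x ⟨hu.1.trans hx.1.le, hx.2⟩).1
    have hzero := (intervalIntegral.integral_eq_zero_iff_of_le_of_nonneg_ae hu.2 hnonneg
      (ha.intervalIntegrable hu (right_mem_Icc.2 hT))).1 hu0
    filter_upwards [(ae_restrict_iff' measurableSet_Ioc).1 hzero] with τ hτ hm
    exact hτ (Ioo_subset_Ioc_self hm)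
  have hswitch : ThinkThenDo T u a := ⟨hthink, hdo⟩
  rwa [hswitch.pastEffort_of_le ha le_rfl hu.1 hu.2, sub_zero]

/-! ### Optimal policies -/

theorem Standing.lossRate_nonpos {M : ThinkDo} (hM : M.Standing)
    (hV : Tendsto M.V atTop (𝓝 M.B)) {T : ℝ} {a : ℝ → ℝ} (ha : Admissible T a) {τ : ℝ}
    (hτ : τ ∈ Icc 0 T) : M.lossRate T a τ ≤ 0 :=
  mul_nonpos_of_nonneg_of_nonpos (sub_nonneg.2 (ha.2 τ hτ).2)
    (mul_nonpos_of_nonneg_of_nonpos (mul_pos hM.mu_pos (Real.exp_pos _)).le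
      (hM.delayGain_nonpos hV hτ.1 (ha.pastEffort_mem_Icc hτ).1))

theorem Standing.payoff_le_switchPayoff {M : ThinkDo} (hM : M.Standing)
    (hV : Tendsto M.V atTop (𝓝 M.B)) (hc : M.c = 0) {T : ℝ} (hT : 0 ≤ T) {a : ℝ → ℝ}
    (ha : Admissible T a) : M.payoff T a ≤ M.switchPayoff T (pastEffort T a 0) := by
  rw [hM.payoff_eq hc hT ha, switchPayoff]
  have := intervalIntegral.integral_nonneg (f := fun τ => -M.lossRate T a τ) (μ := volume) hT
    fun τ hτ => neg_nonneg.2 (hM.lossRate_nonpos hV ha hτ)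
  rw [intervalIntegral.integral_neg] at this
  linarith

/-- Equality case of the exchange: a nonpositive loss with zero integral vanishes almost everywhere,
and `delayGain` is strictly negative once `A > 0`, which forces full effort on doing. -/
theorem Standing.thinkThenDo_of_switchPayoff_le {M : ThinkDo} (hM : M.Standing)
    (hV : Tendsto M.V atTop (𝓝 M.B)) (hc : M.c = 0) {T : ℝ} (hT : 0 ≤ T) {a : ℝ → ℝ}
    (ha : Admissible T a) (h : M.switchPayoff T (pastEffort T a 0) ≤ M.payoff T a) :
    ThinkThenDo T (pastEffort T a 0) a := by
  have heq : ∫ τ in (0 : ℝ)..T, -M.lossRate T a τ = 0 := by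
    have h1 := hM.payoff_eq hc hT ha
    have h2 := (hM.payoff_le_switchPayoff hV hc hT ha).antisymm h
    rw [switchPayoff] at h2
    rw [intervalIntegral.integral_neg]
    linarith
  have hnonneg : 0 ≤ᵐ[volume.restrict (Ioc 0 T)] fun τ => -M.lossRate T a τ := by
    filter_upwards [ae_restrict_mem measurableSet_Ioc] with τ hτ
    exact neg_nonneg.2 (hM.lossRate_nonpos hV ha (Ioc_subset_Icc_self hτ))
  have hzero := (intervalIntegral.integral_eq_zero_iff_of_le_of_nonneg_ae hT hnonneg
    (hM.intervalIntegrable_lossRate hT ha).neg).1 heq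
  refine ha.thinkThenDo hT ?_
  filter_upwards [(ae_restrict_iff' measurableSet_Ioc).1 hzero] with τ hτ hm
  have hl : M.lossRate T a τ = 0 := neg_eq_zero.1 (hτ hm)
  have hA := (ha.pastEffort_mem_Icc (Ioc_subset_Icc_self hm)).1
  rcases hA.eq_or_lt with h0 | h0
  · exact Or.inl h0.symm
  · right
    have hne := (mul_neg_of_pos_of_neg
      (mul_pos hM.mu_pos (Real.exp_pos (-M.mu * (T - τ - pastEffort T a τ))))
      (hM.delayGain_neg hV hm.1.le h0)).ne
    linarith [(mul_eq_zero.1 hl).resolve_right hne]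

/-- A policy is optimal exactly if it switches at the sign change of the switching gain, or at
the outset if that comes later. -/
theorem Standing.isOptimal_iff {M : ThinkDo} (hM : M.Standing)
    (hV : Tendsto M.V atTop (𝓝 M.B)) (hc : M.c = 0) {T r : ℝ} (hT : 0 < T) (hr : 0 < r)
    (hpos : ∀ s, 0 ≤ s → s < r → 0 < M.switchGain s) (hneg : ∀ s, r < s → M.switchGain s < 0)
    {a : ℝ → ℝ} : M.IsOptimal T a ↔ Admissible T a ∧ ThinkThenDo T (min r T) a := by
  have hmin : min r T ∈ Icc 0 T := ⟨le_min hr.le hT.le, min_le_right r T⟩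
  have hA : ∀ b, Admissible T b → pastEffort T b 0 ∈ Icc 0 T := fun b hb => by
    simpa using hb.pastEffort_mem_Icc (left_mem_Icc.2 hT.le)
  constructor
  · rintro ⟨ha, hopt⟩
    refine ⟨ha, ?_⟩
    obtain ⟨b, hb, hbs⟩ := exists_admissible_thinkThenDo T (min r T)
    have h1 := hopt b hb
    rw [hbs.payoff_eq hM hc hb hmin] at h1
    have h2 := hM.payoff_le_switchPayoff hV hc hT.le ha
    have h3 : pastEffort T a 0 = min r T := by
      by_contra hne
      exact (hM.switchPayoff_lt hr hpos hneg (hA a ha) hne).not_ge (h1.trans h2)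
    rw [← h3] at h1 ⊢
    exact hM.thinkThenDo_of_switchPayoff_le hV hc hT.le ha h1
  · rintro ⟨ha, has⟩
    refine ⟨ha, fun b hb => ?_⟩
    rw [has.payoff_eq hM hc ha hmin]
    refine (hM.payoff_le_switchPayoff hV hc hT.le hb).trans ?_
    rcases eq_or_ne (pastEffort T b 0) (min r T) with h | h
    · rw [h]
    · exact (hM.switchPayoff_lt hr hpos hneg (hA b hb) h).le

/-! ### The preference for thinking at the outset -/

/-- On the doing phase the co-state integrand is an exact derivative; on the thinking phase it
reduces to a multiple of the discounted thinking rate. -/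
theorem ThinkThenDo.relPref_eq {M : ThinkDo} (hM : M.Standing) (hc : M.c = 0) {T s : ℝ}
    {a : ℝ → ℝ} (ha : Admissible T a) (hs : s ∈ Icc 0 T) (h : ThinkThenDo T s a) :
    M.relPref T a T = M.mu * M.V T - M.pbar * M.lam * M.B +
      Real.exp (-M.mu * (T - s)) *
        ((M.lam - M.mu) * M.pbar * M.B * (1 - Real.exp (-M.lam * s))) -
      (M.mu - M.lam * M.pbar) *
        ∫ τ in s..T, Real.exp (-M.mu * (T - τ)) * (M.mu * M.extV τ) := by
  have hT : 0 ≤ T := hs.1.trans hs.2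
  have hext := hM.continuous_extV
  set f : ℝ → ℝ := fun τ =>
    Real.exp (-M.mu * (T - τ - pastEffort T a τ)) *
      (M.mu * (1 - M.pbar) * ((1 - a τ) * M.mu * M.V τ - M.c) -
        (M.lam - M.mu) * Real.exp (-M.lam * pastEffort T a τ) * M.pbar *
          ((1 - a τ) * M.mu * M.V τ + a τ * M.lam * M.B - M.c)) with hf
  set K : ℝ := -(Real.exp (-M.mu * (T - s)) * ((M.lam - M.mu) * M.pbar * M.B)) with hK
  have hdo : ∀ᵐ τ, τ ∈ uIoc 0 s →
      K * (Real.exp (-M.lam * (s - τ)) * (-M.lam * -1)) = f τ := by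
    filter_upwards [h.ae_eq] with τ hτ hm
    rw [uIoc_of_le hs.1] at hm
    rw [hf]
    simp only [hτ.2 hm, h.pastEffort_of_le ha hm.1.le hm.2 hs.2, hc, hK,
      show T - τ - (s - τ) = T - s by ring]
    ring
  have hthink : ∀ᵐ τ, τ ∈ uIoc s T →
      (M.mu - M.lam * M.pbar) * (Real.exp (-M.mu * (T - τ)) * (M.mu * M.extV τ)) = f τ := by
    filter_upwards [h.ae_eq] with τ hτ hm
    rw [uIoc_of_le hs.2] at hm
    rw [hf]
    simp only [hτ.1 hm, h.pastEffort_of_ge hm.1.le hm.2, hc,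
      M.extV_of_nonneg (hs.1.trans hm.1.le), mul_zero, Real.exp_zero, sub_zero]
    ring
  have hdi : IntervalIntegrable
      (fun τ => K * (Real.exp (-M.lam * (s - τ)) * (-M.lam * -1))) volume 0 s :=
    Continuous.intervalIntegrable (by fun_prop) _ _
  have hti : IntervalIntegrable (fun τ => (M.mu - M.lam * M.pbar) *
      (Real.exp (-M.mu * (T - τ)) * (M.mu * M.extV τ))) volume s T :=
    Continuous.intervalIntegrable (by fun_prop) _ _
  have hsplit : M.costate T a T = (∫ τ in (0 : ℝ)..s, f τ) + ∫ τ in s..T, f τ :=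
    (intervalIntegral.integral_add_adjacent_intervals
      (hdi.congr_ae ((ae_restrict_iff' measurableSet_uIoc).2 hdo))
      (hti.congr_ae ((ae_restrict_iff' measurableSet_uIoc).2 hthink))).symm
  have hdv : ∫ τ in (0 : ℝ)..s, K * (Real.exp (-M.lam * (s - τ)) * (-M.lam * -1)) =
      K * Real.exp (-M.lam * (s - s)) - K * Real.exp (-M.lam * (s - 0)) :=
    intervalIntegral.integral_eq_sub_of_hasDerivAt (f := fun τ => K * Real.exp (-M.lam * (s - τ)))
      (fun τ _ => (((((hasDerivAt_id τ).const_sub s).const_mul (-M.lam)).exp).const_mul K)) hdi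
  rw [← intervalIntegral.integral_congr_ae hdo, ← intervalIntegral.integral_congr_ae hthink, hdv,
    intervalIntegral.integral_const_mul] at hsplit
  rw [relPref, hsplit, pastEffort_self]
  simp only [sub_self, sub_zero, mul_zero, Real.exp_zero, hK]
  ring

theorem Standing.le_integral_thinkRate {M : ThinkDo} (hM : M.Standing)
    (hV : Tendsto M.V atTop (𝓝 M.B)) {T s : ℝ} (hs : s ∈ Icc 0 T) :
    Real.exp (-M.mu * (T - s)) * (M.mu * M.V s - M.pbar * M.lam * M.B) ≤
      M.mu * M.V T - M.pbar * M.lam * M.B - (M.mu - M.lam * M.pbar) *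
        ∫ τ in s..T, Real.exp (-M.mu * (T - τ)) * (M.mu * M.extV τ) := by
  have hext := hM.continuous_extV
  have hd : ∀ x, 0 < x → HasDerivAt (fun t => Real.exp (-M.mu * (T - t)) *
        (M.mu * M.V t - M.pbar * M.lam * M.B) - (M.mu - M.lam * M.pbar) *
        ∫ τ in s..t, Real.exp (-M.mu * (T - τ)) * (M.mu * M.extV τ))
      (Real.exp (-M.mu * (T - x)) * (-M.mu * -1) * (M.mu * M.V x - M.pbar * M.lam * M.B) +
        Real.exp (-M.mu * (T - x)) * (M.mu * deriv M.V x) - (M.mu - M.lam * M.pbar) *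
        (Real.exp (-M.mu * (T - x)) * (M.mu * M.extV x))) x := fun x hx =>
    ((((hasDerivAt_id x).const_sub T).const_mul (-M.mu)).exp.mul
      (((hM.hasDerivAt_V hx).const_mul _).sub_const _)).sub
        ((Continuous.integral_hasStrictDerivAt (by fun_prop) s x).hasDerivAt.const_mul _)
  -- The claim compares this function of the upper end `t` at `s` and at `T`. Its derivative is `mu
  -- * exp (-mu * (T - t))` times the slack in `shortfall_le_deriv`.
  have hmono : MonotoneOn (fun t => Real.exp (-M.mu * (T - t)) *
      (M.mu * M.V t - M.pbar * M.lam * M.B) - (M.mu - M.lam * M.pbar) *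
      ∫ τ in s..t, Real.exp (-M.mu * (T - τ)) * (M.mu * M.extV τ)) (Ici 0) := by
    refine monotoneOn_of_deriv_nonneg (convex_Ici 0) ?_ ?_ ?_
    · have hVc := hM.continuousOn_V
      refine ContinuousOn.sub (by fun_prop) (continuousOn_const.mul ?_)
      exact (intervalIntegral.continuous_primitive
        (fun _ _ => Continuous.intervalIntegrable (by fun_prop) _ _) s).continuousOn
    · rw [interior_Ici]
      exact fun x hx => (hd x hx).differentiableAt.differentiableWithinAt
    · rw [interior_Ici]
      intro x hx
      rw [(hd x hx).deriv, M.extV_of_nonneg (le_of_lt hx)]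
      have h := mul_nonneg (mul_pos (Real.exp_pos (-M.mu * (T - x))) hM.mu_pos).le
        (sub_nonneg.2 (hM.shortfall_le_deriv hV hx))
      linarith
  have h := hmono (mem_Ici.2 hs.1) (mem_Ici.2 (hs.1.trans hs.2)) hs.2
  simpa using h

theorem ThinkThenDo.neg_switchGain_le_relPref {M : ThinkDo} (hM : M.Standing)
    (hV : Tendsto M.V atTop (𝓝 M.B)) (hc : M.c = 0) {T s : ℝ} {a : ℝ → ℝ}
    (ha : Admissible T a) (hs : s ∈ Icc 0 T) (h : ThinkThenDo T s a) :
    -(Real.exp (-M.mu * (T - s)) * M.switchGain s) ≤ M.relPref T a T := by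
  rw [h.relPref_eq hM hc ha hs, switchGain]
  have := hM.le_integral_thinkRate hV hs
  linarith

theorem ThinkThenDo.relPref_eq_neg_switchGain {M : ThinkDo} (hM : M.Standing) (hc : M.c = 0)
    {T : ℝ} (hT : 0 ≤ T) {a : ℝ → ℝ} (ha : Admissible T a) (h : ThinkThenDo T T a) :
    M.relPref T a T = -M.switchGain T := by
  rw [h.relPref_eq hM hc ha (right_mem_Icc.2 hT), intervalIntegral.integral_same, sub_self,
    mul_zero, Real.exp_zero, switchGain]
  ring

end ThinkDo

theorem proposition2 (M : ThinkDo) (hM : M.Standing)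
    (hV : Tendsto M.V atTop (𝓝 M.B)) (hc : M.c = 0) (T : ℝ) (hT : 0 < T) :
    (∃ a, M.IsOptimal T a) ∧
    (∀ a, M.IsOptimal T a →
      ((∃ s ∈ Ioo 0 T, ThinkDo.ThinkThenDo T s a) ∨ ThinkDo.DoThroughout T a) ∧
      (ThinkDo.StartsThinking T a ↔ ∃ τ ∈ Ioo 0 T, M.SwitchEq τ) ∧
      (0 ≤ M.relPref T a T ↔ ∃ τ ∈ Ioc 0 T, M.SwitchEq τ) ∧
      ((∃ τ ∈ Ioc 0 T, M.SwitchEq τ) →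
        ∃ τ₃, IsLeast {τ | τ ∈ Ioc 0 T ∧ M.SwitchEq τ} τ₃ ∧ ThinkDo.ThinkThenDo T τ₃ a)) ∧
    (∃ τ, 0 < τ ∧ M.SwitchEq τ) := by
  obtain ⟨r, hr, hr0, hpos, hneg⟩ := hM.exists_switch hV
  have hopt := fun a => hM.isOptimal_iff hV hc hT hr hpos hneg (a := a)
  have hroot : ∀ τ, 0 < τ → (M.SwitchEq τ ↔ τ = r) := fun τ hτ => by
    rw [hM.switchEq_iff hτ.le]
    refine ⟨fun h => ?_, fun h => h ▸ hr0⟩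
    rcases lt_trichotomy τ r with hlt | heq | hgt
    · exact absurd h (hpos τ hτ.le hlt).ne'
    · exact heq
    · exact absurd h (hneg τ hgt).ne
  have hIoo : (∃ τ ∈ Ioo 0 T, M.SwitchEq τ) ↔ r < T :=
    ⟨fun ⟨τ, hτ, h⟩ => (hroot τ hτ.1).1 h ▸ hτ.2, fun h => ⟨r, ⟨hr, h⟩, (hroot r hr).2 rfl⟩⟩
  have hIoc : (∃ τ ∈ Ioc 0 T, M.SwitchEq τ) ↔ r ≤ T :=
    ⟨fun ⟨τ, hτ, h⟩ => (hroot τ hτ.1).1 h ▸ hτ.2, fun h => ⟨r, ⟨hr, h⟩, (hroot r hr).2 rfl⟩⟩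
  refine ⟨?_, fun a ha => ?_, r, hr, (hroot r hr).2 rfl⟩
  · obtain ⟨a, ha⟩ := ThinkDo.exists_admissible_thinkThenDo T (min r T)
    exact ⟨a, (hopt a).2 ha⟩
  obtain ⟨hadm, hsw⟩ := (hopt a).1 ha
  rw [hIoo, hIoc]
  refine ⟨?_, ⟨?_, fun h => ?_⟩, ⟨fun h => ?_, fun h => ?_⟩, fun h => ?_⟩
  · rcases lt_or_ge r T with h | h
    · rw [min_eq_left h.le] at hsw
      exact Or.inl ⟨r, ⟨hr, h⟩, hsw⟩
    · rw [min_eq_right h] at hsw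
      exact Or.inr hsw.2
  · rintro ⟨s, hs, hs0⟩
    by_contra! h
    rw [min_eq_right h] at hsw
    -- Doing throughout and thinking on `Ioo s T` conflict, so this interval of positive length
    -- would be null.
    have hnull : ∀ᵐ τ, τ ∉ Ioo s T := by
      filter_upwards [hs0, hsw.2] with τ h0 h1 hm
      have := h1 ⟨hs.1.trans_lt hm.1, hm.2⟩
      rw [h0 hm] at this
      exact zero_ne_one this
    have hzero : volume (Ioo s T) = 0 := measure_eq_zero_iff_ae_notMem.2 hnull
    rw [Real.volume_Ioo, ENNReal.ofReal_eq_zero] at hzero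
    linarith [hs.2]
  · rw [min_eq_left h.le] at hsw
    exact ⟨r, ⟨hr.le, h⟩, hsw.1⟩
  · by_contra! hlt
    rw [min_eq_right hlt.le] at hsw
    rw [hsw.relPref_eq_neg_switchGain hM hc hT.le hadm] at h
    linarith [hpos T hT.le hlt]
  · rw [min_eq_left h] at hsw
    -- At the root `r` the lower bound for the relative preference is zero.
    simpa [hr0] using hsw.neg_switchGain_le_relPref hM hV hc hadm ⟨hr.le, h⟩
  · rw [min_eq_left h] at hsw
    exact ⟨r, ⟨⟨⟨hr, h⟩, (hroot r hr).2 rfl⟩, fun τ hτ => ((hroot τ hτ.1.1).1 hτ.2).ge⟩, hsw⟩
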